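/- Let $\mu$ be the law of a random variable $Z$ such that: (1) $\mathbb E[Z]>1$ and $\mathbb E[\log Z]<0$; (2) there are $0<c_-<c_+<\infty$ such that $[c_-,c_+]$ is the smallest closed interval with $\mathbb P(Z\in[c_-,c_+])=1$; (3) $\mu$ has a continuously differentiable density on $\mathbb R$ with respect to Lebesgue measure. Let $\alpha>0$ be the positive real solution of $\mathbb E[Z^\alpha]=1$, and fix $y\in\left(0,\min(c_+-1,\,c_+/2)\right)$. For $\varepsilon\in(0,1)$ let $\nu_\varepsilon$ be the stationary probability measure on $(0,\infty)$ of the Markov chain $s\mapsto Z\,\frac{1+s}{1+\varepsilon^2 s}$ (at each step $Z$ has law $\mu$ and is independent of the past), and let $\omega_\varepsilon$ be the measure on $(0,\infty)$ with $$\omega_\varepsilon((\sigma,\infty))=\frac{\nu_\varepsilon((\varepsilon^{-2}\sigma,\infty))}{\nu_\varepsilon((\varepsilon^{-2}y,\infty))}\qquad(\sigma>0).$$ Let $\omega_0$ be a limit point of $\omega_\varepsilon$ as $\varepsilon\searrow0$, that is, a Borel measure on $(0,\infty)$ for which there is a sequence $\varepsilon_n\in(0,1)$, $\varepsilon_n\to0$,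 with $\int f\,d\omega_{\varepsilon_n}\to\int f\,d\omega_0$ for every nonnegative bounded continuous function $f$ on $(0,\infty)$ that vanishes in a neighbourhood of $0$. Then $G_{\omega_0}(\sigma):=\omega_0((\sigma,\infty))$ is finite for every $\sigma>0$, and there are a constant $C_\omega\neq0$ and a function $R_\omega:(0,\infty)\to\mathbb R$ such that $$G_{\omega_0}(\sigma)=C_\omega\left[\sigma^{-\alpha}+R_\omega(\sigma)\right]\quad\text{for all }\sigma>0,\qquad R_\omega(\sigma)=O(1)\ \text{ as }\sigma\searrow0.$$ -/

import Mathlib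

open Set Filter Topology MeasureTheory
open scoped NNReal ENNReal BoundedContinuousFunction

namespace DerridaHilhorst

/-- Standing assumptions on the law `μ` of the positive random variable `Z`:
`E[Z] > 1`, `E[log Z] < 0`, `[cm, cp] ⊂ (0, ∞)` is the smallest closed interval carrying `μ`,
and `μ` has a continuously differentiable density with respect to Lebesgue measure. -/
structure IsDisorderLaw (μ : Measure ℝ) (cm cp : ℝ) : Prop where
  isProbabilityMeasure : IsProbabilityMeasure μ
  one_lt_mean : 1 < ∫ z, z ∂μ
  mean_log_neg : ∫ z, Real.log z ∂μ < 0
  cm_pos : 0 < cm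
  cm_lt_cp : cm < cp
  measure_Icc : μ (Icc cm cp) = 1
  minimal : ∀ a b : ℝ, μ (Icc a b) = 1 → Icc cm cp ⊆ Icc a b
  density : ∃ ρ : ℝ → ℝ, ContDiff ℝ 1 ρ ∧ (∀ x, 0 ≤ ρ x) ∧
    μ = volume.withDensity (fun x => ENNReal.ofReal (ρ x))

/-- The function `g_ε(s) = (1 + s) / (1 + ε² s)`. -/
noncomputable def g (ε s : ℝ) : ℝ := (1 + s) / (1 + ε ^ 2 * s)

/-- The one-step transition `ν ↦ T_ε ν` of the chain `s ↦ Z g_ε(s)`: the law of `Z g_ε(s)` when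
`Z` has law `μ` and `s` is independent of `Z` with law `ν`. -/
noncomputable def T (μ : Measure ℝ) (ε : ℝ) (ν : Measure ℝ) : Measure ℝ :=
  (μ.prod ν).map (fun p : ℝ × ℝ => p.1 * g ε p.2)

/-- `ν` is the stationary probability `ν_ε` on `(0, ∞)` of the chain `s ↦ Z g_ε(s)`. -/
structure IsStationaryLaw (μ : Measure ℝ) (ε : ℝ) (ν : Measure ℝ) : Prop where
  isProbabilityMeasure : IsProbabilityMeasure ν
  measure_Iic_zero : ν (Iic 0) = 0
  stationary : T μ ε ν = ν

/-- The rescaled and renormalised measure `ω_ε` built from `ν = ν_ε`; its tail is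
`ω_ε((σ, ∞)) = ν((ε⁻² σ, ∞)) / ν((ε⁻² y, ∞))`, so that `ω_ε((y, ∞)) = 1`. -/
noncomputable def omega (y ε : ℝ) (ν : Measure ℝ) : Measure ℝ :=
  (ν (Ioi (y / ε ^ 2)))⁻¹ • ν.map (fun s => ε ^ 2 * s)

/-- Convergence of measures on `(0, ∞)` tested against the bounded continuous functions that vanish
in a neighbourhood of `0`. Nonnegative test functions and the `ℝ≥0∞`-valued integral are
used, so that no integrability is presupposed; a bounded continuous function on `(0, ∞)` vanishing
near `0` is extended by `0` to `ℝ`. -/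
def TendstoAwayFromZero (ω : ℕ → Measure ℝ) (ω₀ : Measure ℝ) : Prop :=
  ∀ f : ℝ →ᵇ ℝ≥0, (∃ δ : ℝ, 0 < δ ∧ ∀ x ≤ δ, f x = 0) →
    Tendsto (fun n => ∫⁻ x, (f x : ℝ≥0∞) ∂(ω n)) atTop (𝓝 (∫⁻ x, (f x : ℝ≥0∞) ∂ω₀))

/-- `ω₀` is a limit point of the family `ω_ε` as `ε ↘ 0`: a measure on `(0, ∞)` that is the limit
of `ω_{ε_n}` for some sequence `ε_n` in `(0, 1)` with `ε_n → 0`. -/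
def IsLimitPoint (μ : Measure ℝ) (y : ℝ) (ω₀ : Measure ℝ) : Prop :=
  ω₀ (Iic 0) = 0 ∧
  ∃ (ε : ℕ → ℝ) (ν : ℕ → Measure ℝ),
    (∀ n, ε n ∈ Ioo (0 : ℝ) 1) ∧ Tendsto ε atTop (𝓝 0) ∧
    (∀ n, IsStationaryLaw μ (ε n) (ν n)) ∧
    TendstoAwayFromZero (fun n => omega y (ε n) (ν n)) ω₀

end DerridaHilhorst

/-!
In the variable `u = 1 / σ` the limiting chain `x ↦ Z x / (1 + x)` acts on tails through the affine
map `u ↦ Z u - 1`: the event `z x / (1 + x) > 1 / u` is `(z u - 1) x > 1`. Hence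
`H u := ω₀ ((1 / u, ∞))` is nondecreasing, vanishes for `u ≤ 1 / cp`, and satisfies
`H u = E[H (Z u - 1)]`. Passing to the limit is a matter of portmanteau inequalities between nearby
levels and of Fatou's lemma; finiteness comes from `IsDisorderLaw.exists_superharmonic_le`, since
from any level the chain climbs above `y < cp - 1` with a probability bounded below. This is
`IsLimitPoint.isHarmonicTail`.

It remains to show `C (u ^ α - a) ≤ H u ≤ C u ^ α` for some `C > 0`
(`IsHarmonicTail.exists_asymptotics`), which is done by comparison. Here `α < 1`, because
`E[Z] > 1`, and the maximum principle `IsDisorderLaw.nonpos_of_subharmonic` holds because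
`E[Z ^ (α / 2)] < 1`. The function `u ^ α` is superharmonic, so upper bounds `H v ≤ C v ^ α` on a
window `[u₁, cp u₁]` propagate to all `u < u₁`. The function `u ^ α - a + b u ^ (α - 1)` is
subharmonic where it is positive, since `E[Z ^ (α - 1)] > 1`, so lower bounds propagate up to a
bounded loss. In particular `H u / u ^ α` is bounded. Its supremum `C` is nearly attained at
arbitrarily large `u`; a strong maximum principle, resting on the density of `μ` and the
monotonicity of `H`, makes `H v / v ^ α` nearly equal to `C` on whole windows arbitrarily far out,
and the lower barrier carries the bound back to every `u`.
-/

namespace DerridaHilhorst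

variable {μ : Measure ℝ} {cm cp : ℝ}

/-! ### The disorder law and its moments -/

lemma IsDisorderLaw.ae_mem (hμ : IsDisorderLaw μ cm cp) : ∀ᵐ z ∂μ, z ∈ Icc cm cp := by
  have := hμ.isProbabilityMeasure
  exact (mem_ae_iff_prob_eq_one measurableSet_Icc).2 hμ.measure_Icc

lemma IsDisorderLaw.integrable_of_continuousOn (hμ : IsDisorderLaw μ cm cp) {f : ℝ → ℝ}
    (hf : ContinuousOn f (Icc cm cp)) : Integrable f μ := by
  have := hμ.isProbabilityMeasure
  have h := hf.integrableOn_compact (μ := μ) isCompact_Icc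
  rwa [IntegrableOn, Measure.restrict_eq_self_of_ae_mem hμ.ae_mem] at h

lemma IsDisorderLaw.integrable_rpow (hμ : IsDisorderLaw μ cm cp) (s : ℝ) :
    Integrable (fun z : ℝ => z ^ s) μ := by
  refine hμ.integrable_of_continuousOn fun z hz => ?_
  exact (Real.continuousAt_rpow_const z s (Or.inl (hμ.cm_pos.trans_le hz.1).ne')).continuousWithinAt

lemma IsDisorderLaw.integrable_mul_rpow (hμ : IsDisorderLaw μ cm cp) (s : ℝ) {u : ℝ} (hu : 0 < u) :
    Integrable (fun z : ℝ => (z * u) ^ s) μ := by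
  refine ((hμ.integrable_rpow s).mul_const (u ^ s)).congr ?_
  filter_upwards [hμ.ae_mem] with z hz
  exact (Real.mul_rpow (hμ.cm_pos.le.trans hz.1) hu.le).symm

lemma IsDisorderLaw.integral_mul_rpow (hμ : IsDisorderLaw μ cm cp) (s : ℝ) {u : ℝ} (hu : 0 < u) :
    ∫ z, (z * u) ^ s ∂μ = (∫ z, z ^ s ∂μ) * u ^ s := by
  rw [← integral_mul_const]
  refine integral_congr_ae ?_
  filter_upwards [hμ.ae_mem] with z hz
  exact Real.mul_rpow (hμ.cm_pos.le.trans hz.1) hu.le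

/-- For `s ≥ 1`, Bernoulli's inequality gives `E[Z ^ s] ≥ 1 + s (E[Z] - 1) > 1`. -/
lemma IsDisorderLaw.lt_one_of_integral_rpow_eq_one (hμ : IsDisorderLaw μ cm cp) {α : ℝ}
    (hα : ∫ z, z ^ α ∂μ = 1) : α < 1 := by
  have := hμ.isProbabilityMeasure
  by_contra! h
  have hid : Integrable (fun z : ℝ => z) μ := hμ.integrable_of_continuousOn continuousOn_id
  have hid' : Integrable (fun z : ℝ => z - 1) μ := hid.sub (integrable_const _)
  have h1 : ∫ z, (1 + α * (z - 1)) ∂μ ≤ ∫ z, z ^ α ∂μ := by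
    refine integral_mono_ae ?_ (hμ.integrable_rpow α) ?_
    · exact (integrable_const _).add (hid'.const_mul _)
    · filter_upwards [hμ.ae_mem] with z hz
      have := one_add_mul_self_le_rpow_one_add (s := z - 1) (by linarith [hμ.cm_pos, hz.1]) h
      simpa using this
  rw [integral_add (integrable_const _) (hid'.const_mul _),
    integral_const_mul, integral_sub hid (integrable_const _), hα] at h1
  simp only [integral_const, probReal_univ, smul_eq_mul, mul_one] at h1
  nlinarith [hμ.one_lt_mean]

/-- `2 (1 - E[Z ^ (α / 2)]) = E[(Z ^ (α / 2) - 1) ^ 2] > 0`, as `Z` is not almost surely `1`. -/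
lemma IsDisorderLaw.integral_rpow_half_lt_one (hμ : IsDisorderLaw μ cm cp) {α : ℝ} (hα_pos : 0 < α)
    (hα : ∫ z, z ^ α ∂μ = 1) : ∫ z, z ^ (α / 2) ∂μ < 1 := by
  have := hμ.isProbabilityMeasure
  have hint : Integrable (fun z : ℝ => (z ^ (α / 2) - 1) ^ 2) μ := by
    refine hμ.integrable_of_continuousOn fun z hz => ?_
    exact (((Real.continuousAt_rpow_const z _
      (Or.inl (hμ.cm_pos.trans_le hz.1).ne')).sub continuousAt_const).pow 2).continuousWithinAt
  have h1 : ∫ z, (z ^ (α / 2) - 1) ^ 2 ∂μ = 2 * (1 - ∫ z, z ^ (α / 2) ∂μ) := by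
    have : ∫ z, (z ^ (α / 2) - 1) ^ 2 ∂μ = ∫ z, (z ^ α - 2 * z ^ (α / 2)) + 1 ∂μ := by
      refine integral_congr_ae ?_
      filter_upwards [hμ.ae_mem] with z hz
      have : z ^ α = (z ^ (α / 2)) ^ 2 := by
        rw [← Real.rpow_natCast, ← Real.rpow_mul (hμ.cm_pos.le.trans hz.1)]
        norm_num
      simp only [this]
      ring
    have hsub : Integrable (fun z : ℝ => z ^ α - 2 * z ^ (α / 2)) μ :=
      (hμ.integrable_rpow α).sub ((hμ.integrable_rpow _).const_mul 2)
    rw [this, integral_add hsub (integrable_const _), integral_sub (hμ.integrable_rpow α)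
      ((hμ.integrable_rpow _).const_mul 2), integral_const_mul, hα]
    simp
    ring
  by_contra! h
  have h2 : ∫ z, (z ^ (α / 2) - 1) ^ 2 ∂μ = 0 :=
    le_antisymm (by linarith) (integral_nonneg fun z => sq_nonneg _)
  rw [integral_eq_zero_iff_of_nonneg (fun z => sq_nonneg _) hint] at h2
  have h3 : ∫ z, Real.log z ∂μ = 0 := by
    refine integral_eq_zero_of_ae ?_
    filter_upwards [h2, hμ.ae_mem] with z hz hz'
    have hz0 := hμ.cm_pos.trans_le hz'.1
    have : z ^ (α / 2) = 1 := by
      have : (z ^ (α / 2) - 1) ^ 2 = 0 := hz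
      have := pow_eq_zero_iff (two_ne_zero) |>.1 this
      linarith
    have h4 := congrArg Real.log this
    rw [Real.log_rpow hz0, Real.log_one] at h4
    have : α / 2 ≠ 0 := by positivity
    simpa [hα_pos.ne'] using h4
  linarith [hμ.mean_log_neg]

/-- By `exp x ≥ 1 + x`, for `s < 0` one has `E[Z ^ s] ≥ 1 + s E[log Z] > 1`. -/
lemma IsDisorderLaw.one_lt_integral_rpow_of_neg (hμ : IsDisorderLaw μ cm cp) {s : ℝ} (hs : s < 0) :
    1 < ∫ z, z ^ s ∂μ := by
  have := hμ.isProbabilityMeasure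
  have hlog : Integrable (fun z : ℝ => Real.log z * s) μ := by
    refine (hμ.integrable_of_continuousOn fun z hz => ?_).mul_const s
    exact (Real.continuousAt_log (hμ.cm_pos.trans_le hz.1).ne').continuousWithinAt
  have h1 : ∫ z, (Real.log z * s + 1) ∂μ ≤ ∫ z, z ^ s ∂μ := by
    refine integral_mono_ae (hlog.add (integrable_const _)) (hμ.integrable_rpow s) ?_
    filter_upwards [hμ.ae_mem] with z hz
    rw [Real.rpow_def_of_pos (hμ.cm_pos.trans_le hz.1)]
    exact Real.add_one_le_exp _
  rw [integral_add hlog (integrable_const _), integral_mul_const] at h1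
  simp only [integral_const, probReal_univ, smul_eq_mul, mul_one] at h1
  nlinarith [hμ.mean_log_neg]

/-- The density is continuous and not identically zero on `[cm, cp]`, so it is bounded below on
some interval. -/
lemma IsDisorderLaw.exists_Icc_density_lower_bound (hμ : IsDisorderLaw μ cm cp) :
    ∃ p q m : ℝ, 0 < p ∧ p < q ∧ 0 < m ∧
      ∀ a b, p ≤ a → a ≤ b → b ≤ q → m * (b - a) ≤ μ.real (Ioo a b) := by
  have hprob := hμ.isProbabilityMeasure
  obtain ⟨ρ, hρ, hρ0, hμρ⟩ := hμ.density
  obtain ⟨x, hx, hρx⟩ : ∃ x ∈ Icc cm cp, 0 < ρ x := by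
    by_contra! h
    have h1 : μ (Icc cm cp) = 0 := by
      rw [hμρ, withDensity_apply _ measurableSet_Icc]
      refine (setLIntegral_congr_fun measurableSet_Icc fun z hz => ?_).trans lintegral_zero
      simpa using h z hz
    rw [hμ.measure_Icc] at h1
    exact one_ne_zero h1
  have hx0 : 0 < x := hμ.cm_pos.trans_le hx.1
  have hev : ∀ᶠ z in 𝓝 x, 0 < z ∧ ρ x / 2 < ρ z :=
    (eventually_gt_nhds hx0).and
      (hρ.continuous.continuousAt.eventually (eventually_gt_nhds (half_lt_self hρx)))
  obtain ⟨d, hd, hball⟩ := Metric.eventually_nhds_iff.1 hev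
  have key : ∀ z ∈ Icc (x - d / 2) (x + d / 2), 0 < z ∧ ρ x / 2 < ρ z := fun z hz =>
    hball (by rw [Real.dist_eq, abs_lt]; constructor <;> linarith [hz.1, hz.2])
  refine ⟨x - d / 2, x + d / 2, ρ x / 2, (key _ ⟨le_rfl, by linarith⟩).1, by linarith,
    half_pos hρx, fun a b ha hab hb => ?_⟩
  have h2 : ENNReal.ofReal (ρ x / 2) * ENNReal.ofReal (b - a) ≤ μ (Ioo a b) := by
    conv_rhs => rw [hμρ]
    rw [withDensity_apply _ measurableSet_Ioo, ← Real.volume_Ioo, ← setLIntegral_const]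
    refine setLIntegral_mono' measurableSet_Ioo fun z hz => ENNReal.ofReal_le_ofReal ?_
    exact (key z ⟨ha.trans hz.1.le, hz.2.le.trans hb⟩).2.le
  rw [← ENNReal.ofReal_mul (half_pos hρx).le] at h2
  exact (ENNReal.ofReal_le_iff_le_toReal (measure_ne_top _ _)).1 h2

/-! ### Harmonic functions of the affine chain `u ↦ Z u - 1` -/

/-- Maximum principle for the chain `u ↦ Z u - 1` started in `(0, u₁)`, where the exterior data are
prescribed on the window `[u₁, cp u₁]`, which contains every first exit above `u₁`.
Subharmonicity is required only where `f > 0`, and is expressed through an integrable minorant `g`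
of `z ↦ f (z u - 1)`. Since `E[Z ^ θ] < 1`, iterating the bound `f u ≤ K u ^ θ` gives `f ≤ 0`. -/
lemma IsDisorderLaw.nonpos_of_subharmonic (hμ : IsDisorderLaw μ cm cp) {θ : ℝ} (hθ : 0 < θ)
    (hq : ∫ z, z ^ θ ∂μ < 1) {f : ℝ → ℝ} {u₀ u₁ K : ℝ} (hu₀ : 0 < u₀)
    (hsmall : ∀ u ≤ u₀, f u ≤ 0) (hK : ∀ u < u₁, f u ≤ K)
    (hout : ∀ u ∈ Icc u₁ (cp * u₁), f u ≤ 0)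
    (hsub : ∀ u, 0 < u → u < u₁ → 0 < f u → ∃ g : ℝ → ℝ, Integrable g μ ∧
      (∀ᵐ z ∂μ, g z ≤ f (z * u - 1)) ∧ f u ≤ ∫ z, g z ∂μ) :
    ∀ u < u₁, f u ≤ 0 := by
  set q := ∫ z, z ^ θ ∂μ with hqdef
  have hq0 : 0 ≤ q := by
    refine integral_nonneg_of_ae ?_
    filter_upwards [hμ.ae_mem] with z hz
    exact Real.rpow_nonneg (hμ.cm_pos.le.trans hz.1) _
  set K' := max K 0 / u₀ ^ θ with hK'
  have hu₀θ : 0 < u₀ ^ θ := Real.rpow_pos_of_pos hu₀ _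
  have hK'0 : 0 ≤ K' := div_nonneg (le_max_right _ _) hu₀θ.le
  have key : ∀ n : ℕ, ∀ u, 0 < u → u < u₁ → f u ≤ K' * q ^ n * u ^ θ := by
    intro n
    induction n with
    | zero =>
      intro u hu hu1
      rcases le_or_gt u u₀ with h | h
      · exact (hsmall u h).trans (by positivity)
      · calc f u ≤ max K 0 := (hK u hu1).trans (le_max_left _ _)
          _ = K' * u₀ ^ θ := by rw [hK', div_mul_cancel₀ _ hu₀θ.ne']
          _ ≤ K' * q ^ 0 * u ^ θ := by
            rw [pow_zero, mul_one]
            exact mul_le_mul_of_nonneg_left (Real.rpow_le_rpow hu₀.le h.le hθ.le) hK'0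
    | succ n ih =>
      intro u hu hu1
      rcases le_or_gt (f u) 0 with h | h
      · exact h.trans (by positivity)
      obtain ⟨g, hg, hgf, hfg⟩ := hsub u hu hu1 h
      calc f u ≤ ∫ z, g z ∂μ := hfg
        _ ≤ ∫ z, K' * q ^ n * (z * u) ^ θ ∂μ := by
          refine integral_mono_ae hg ((hμ.integrable_mul_rpow θ hu).const_mul _) ?_
          filter_upwards [hgf, hμ.ae_mem] with z hz hzm
          refine hz.trans ?_
          have hz0 : 0 < z := hμ.cm_pos.trans_le hzm.1
          have hzu : 0 < z * u := mul_pos hz0 hu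
          rcases le_or_gt (z * u - 1) 0 with h0 | h0
          · exact (hsmall _ (h0.trans hu₀.le)).trans (by positivity)
          rcases lt_or_ge (z * u - 1) u₁ with h1 | h1
          · refine (ih _ h0 h1).trans (mul_le_mul_of_nonneg_left ?_ (by positivity))
            exact Real.rpow_le_rpow h0.le (by linarith) hθ.le
          · refine (hout _ ⟨h1, ?_⟩).trans (by positivity)
            have : z * u ≤ cp * u₁ := mul_le_mul hzm.2 hu1.le hu.le (hz0.le.trans hzm.2)
            linarith
        _ = K' * q ^ (n + 1) * u ^ θ := by
          rw [integral_const_mul, hμ.integral_mul_rpow θ hu]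
          ring
  intro u hu1
  rcases le_or_gt u 0 with h | h
  · exact hsmall u (h.trans hu₀.le)
  have hlim : Tendsto (fun n : ℕ => K' * q ^ n * u ^ θ) atTop (𝓝 (K' * 0 * u ^ θ)) :=
    ((tendsto_pow_atTop_nhds_zero_of_lt_one hq0 hq).const_mul K').mul_const _
  have := ge_of_tendsto' hlim fun n => key n u h hu1
  simpa using this

/-- A nondecreasing function, vanishing on a half-line `(-∞, u₀]` with `u₀ > 0`, that is harmonic
for the chain `u ↦ Z u - 1`. The tail `σ ↦ ω₀ (σ, ∞)` of an invariant measure of the limiting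
chain `x ↦ Z x / (1 + x)` has these properties as a function of `u = 1 / σ`. -/
structure IsHarmonicTail (μ : Measure ℝ) (H : ℝ → ℝ) : Prop where
  mono : Monotone H
  vanish : ∃ u₀ : ℝ, 0 < u₀ ∧ ∀ u ≤ u₀, H u = 0
  harmonic : ∀ u, H u = ∫ z, H (z * u - 1) ∂μ

namespace IsHarmonicTail

variable {H : ℝ → ℝ}

lemma nonneg (hH : IsHarmonicTail μ H) (u : ℝ) : 0 ≤ H u := by
  obtain ⟨u₀, -, h⟩ := hH.vanish
  rcases le_total u u₀ with hu | hu
  · exact (h u hu).ge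
  · exact (h u₀ le_rfl).ge.trans (hH.mono hu)

lemma integrable (hH : IsHarmonicTail μ H) (hμ : IsDisorderLaw μ cm cp) {u : ℝ} (hu : 0 ≤ u) :
    Integrable (fun z => H (z * u - 1)) μ := by
  have := hμ.isProbabilityMeasure
  have hm : Monotone fun z => H (z * u - 1) := fun a b hab =>
    hH.mono (sub_le_sub_right (mul_le_mul_of_nonneg_right hab hu) 1)
  have h := (hm.monotoneOn (Icc cm cp)).integrableOn_isCompact (μ := μ) isCompact_Icc
  rwa [IntegrableOn, Measure.restrict_eq_self_of_ae_mem hμ.ae_mem] at h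

/-- The power `u ^ α` is superharmonic, so a bound `H v ≤ C v ^ α` on a window propagates
downwards. -/
lemma le_mul_rpow_of_window (hH : IsHarmonicTail μ H) (hμ : IsDisorderLaw μ cm cp) {α : ℝ}
    (hα_pos : 0 < α) (hα : ∫ z, z ^ α ∂μ = 1) {C u₁ : ℝ} (hC : 0 ≤ C)
    (hw : ∀ v ∈ Icc u₁ (cp * u₁), H v ≤ C * v ^ α) {u : ℝ} (hu : 0 < u) (hu1 : u < u₁) :
    H u ≤ C * u ^ α := by
  obtain ⟨u₀, hu₀, hv⟩ := hH.vanish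
  have hu₁ : 0 < u₁ := hu.trans hu1
  have hprob := hμ.isProbabilityMeasure
  -- The positive part avoids the values of `rpow` at negative arguments.
  have hmain := hμ.nonpos_of_subharmonic (half_pos hα_pos) (hμ.integral_rpow_half_lt_one hα_pos hα)
    (f := fun u => H u - C * (max u 0) ^ α) (u₁ := u₁) (K := H u₁) hu₀
    (fun u hu => by
      have : 0 ≤ C * (max u 0) ^ α := mul_nonneg hC (Real.rpow_nonneg (le_max_right _ _) _)
      simp only [hv u hu]
      linarith)
    (fun u hu => by
      have : 0 ≤ C * (max u 0) ^ α := mul_nonneg hC (Real.rpow_nonneg (le_max_right _ _) _)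
      have := hH.mono hu.le
      linarith)
    (fun u hu => by
      simp only [max_eq_left (hu₁.le.trans hu.1)]
      linarith [hw u hu])
    (fun u hu _ _ => by
      have hi := hH.integrable hμ hu.le
      have hi' := (hμ.integrable_mul_rpow α hu).const_mul C
      refine ⟨fun z => H (z * u - 1) - C * (z * u) ^ α, hi.sub hi', ?_, ?_⟩
      · filter_upwards [hμ.ae_mem] with z hz
        have hz0 : 0 < z * u := mul_pos (hμ.cm_pos.trans_le hz.1) hu
        have : (max (z * u - 1) 0) ^ α ≤ (z * u) ^ α :=
          Real.rpow_le_rpow (le_max_right _ _) (max_le (by linarith) hz0.le) hα_pos.le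
        linarith [mul_le_mul_of_nonneg_left this hC]
      · rw [integral_sub hi hi', ← hH.harmonic u, integral_const_mul, hμ.integral_mul_rpow α hu,
          hα, one_mul, max_eq_left hu.le]) u hu1
  simp only [max_eq_left hu.le] at hmain
  linarith

end IsHarmonicTail

/-- For suitable `1 ≤ b ≤ a`, the function `u ^ α - a + b u ^ (α - 1)` is subharmonic where it is
positive on `[1, ∞)`, so that a lower bound `c v ^ α ≤ H` on a window propagates downwards up to a
bounded loss. The bounded loss comes from the constant being harmonic, and `b` is chosen so that
the gain `b (E[Z ^ (α - 1)] - 1) u ^ (α - 1)` pays for the defect of `u ^ α`. -/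
lemma IsDisorderLaw.exists_lower_barrier (hμ : IsDisorderLaw μ cm cp) {α : ℝ} (hα_pos : 0 < α)
    (hα : ∫ z, z ^ α ∂μ = 1) :
    ∃ a b : ℝ, 1 ≤ b ∧ b ≤ a ∧ ∀ H : ℝ → ℝ, IsHarmonicTail μ H → ∀ c u₁ : ℝ, 0 ≤ c →
      (∀ v ∈ Icc u₁ (cp * u₁), c * v ^ α ≤ H v) → ∀ u, 1 ≤ u → u < u₁ →
        c * (u ^ α - a + b * u ^ (α - 1)) ≤ H u := by
  have hα1 := hμ.lt_one_of_integral_rpow_eq_one hα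
  have hprob := hμ.isProbabilityMeasure
  have hΦ := hμ.one_lt_integral_rpow_of_neg (s := α - 1) (by linarith)
  set Φ := ∫ z, z ^ (α - 1) ∂μ with hΦdef
  have hcm := hμ.cm_pos
  set b := Φ / (Φ - 1) with hb
  have hb1 : 1 ≤ b := by
    rw [hb, le_div_iff₀ (by linarith)]
    linarith
  have hbΦ : (b - 1) * Φ = b := by
    have : Φ - 1 ≠ 0 := by linarith
    rw [hb]
    field_simp
    ring
  have h2cm : 0 < (2 / cm) ^ α := Real.rpow_pos_of_pos (by positivity) _
  refine ⟨b + (2 / cm) ^ α, b, hb1, by linarith, fun H hH c u₁ hc hw u hu hu1 => ?_⟩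
  set a := b + (2 / cm) ^ α with ha
  have hrpow_le : ∀ v : ℝ, 1 ≤ v → v ^ (α - 1) ≤ 1 := fun v hv =>
    Real.rpow_le_one_of_one_le_of_nonpos hv (by linarith)
  have hmain := hμ.nonpos_of_subharmonic (half_pos hα_pos) (hμ.integral_rpow_half_lt_one hα_pos hα)
    (f := fun u => if 1 ≤ u then c * (u ^ α - a + b * u ^ (α - 1)) - H u else 0)
    (u₁ := u₁) (K := c * u₁ ^ α) (u₀ := 1 / 2) (by norm_num)
    (fun u hu => by rw [if_neg (by linarith)])
    (fun v hv => by
      split_ifs with h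
      · have h1 := hrpow_le v h
        have h2 : v ^ α ≤ u₁ ^ α := Real.rpow_le_rpow (by linarith) hv.le hα_pos.le
        have h3 : v ^ α - a + b * v ^ (α - 1) ≤ u₁ ^ α := by nlinarith
        linarith [mul_le_mul_of_nonneg_left h3 hc, hH.nonneg v]
      · exact mul_nonneg hc (Real.rpow_nonneg (by linarith) _))
    (fun v hv => by
      have h : 1 ≤ v := by linarith [hv.1]
      rw [if_pos h]
      have h1 := hrpow_le v h
      have h3 : v ^ α - a + b * v ^ (α - 1) ≤ v ^ α := by nlinarith
      linarith [mul_le_mul_of_nonneg_left h3 hc, hw v hv])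
    (fun u hu _ hpos => by
      have h1 : 1 ≤ u := by
        by_contra h
        simp [h] at hpos
      simp only [if_pos h1] at hpos ⊢
      have hi := hH.integrable hμ hu.le
      have hiα := hμ.integrable_mul_rpow α hu
      have hiα1 := (hμ.integrable_mul_rpow (α - 1) hu).const_mul (b - 1)
      have hi' : Integrable (fun z : ℝ => c * ((z * u) ^ α - a + (b - 1) * (z * u) ^ (α - 1))) μ :=
        ((hiα.sub (integrable_const _)).add hiα1).const_mul c
      -- Positivity forces `u > 2 / cm`, so that the next step `z u - 1` stays above `1`.
      have hularge : 2 / cm ≤ u := by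
        have hP : 0 < c * (u ^ α - a + b * u ^ (α - 1)) := by linarith [hH.nonneg u]
        have hP' := pos_of_mul_pos_right hP hc
        have h2 := hrpow_le u h1
        have h3 : (2 / cm) ^ α < u ^ α := by nlinarith
        exact ((Real.rpow_lt_rpow_iff (by positivity) hu.le hα_pos).1 h3).le
      refine ⟨fun z => c * ((z * u) ^ α - a + (b - 1) * (z * u) ^ (α - 1)) - H (z * u - 1),
        hi'.sub hi, ?_, ?_⟩
      · filter_upwards [hμ.ae_mem] with z hz
        have hzu : 2 ≤ z * u := by
          calc (2 : ℝ) = cm * (2 / cm) := by field_simp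
            _ ≤ z * u := mul_le_mul hz.1 hularge (by positivity) (hcm.le.trans hz.1)
        have hzu0 : 0 < z * u := by linarith
        rw [if_pos (by linarith)]
        refine sub_le_sub_right (mul_le_mul_of_nonneg_left ?_ hc) _
        have e1 : (z * u) ^ α - (z * u) ^ (α - 1) ≤ (z * u - 1) ^ α := by
          have hx : z * u - 1 = z * u * (1 - (z * u)⁻¹) := by
            rw [mul_sub, mul_one, mul_inv_cancel₀ hzu0.ne']
          have hinv : (z * u)⁻¹ < 1 := inv_lt_one_of_one_lt₀ (by linarith)
          have hpos : 0 < 1 - (z * u)⁻¹ := by linarith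
          rw [hx, Real.mul_rpow hzu0.le hpos.le, Real.rpow_sub_one hzu0.ne', div_eq_mul_inv]
          have : 1 - (z * u)⁻¹ ≤ (1 - (z * u)⁻¹) ^ α := by
            have hi0 : 0 < (z * u)⁻¹ := by positivity
            exact Real.self_le_rpow_of_le_one hpos.le (by linarith) hα1.le
          nlinarith [Real.rpow_pos_of_pos hzu0 α]
        have e2 : (z * u) ^ (α - 1) ≤ (z * u - 1) ^ (α - 1) :=
          Real.rpow_le_rpow_of_nonpos (by linarith) (by linarith) (by linarith)
        nlinarith
      · rw [integral_sub hi' hi, ← hH.harmonic u, integral_const_mul,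
          integral_add (f := fun z : ℝ => (z * u) ^ α - a) (hiα.sub (integrable_const _)) hiα1,
          integral_sub hiα (integrable_const _), integral_const_mul, hμ.integral_mul_rpow α hu,
          hμ.integral_mul_rpow (α - 1) hu, hα, ← hΦdef, ← mul_assoc, hbΦ]
        simp) u hu1
  simp only [if_pos hu] at hmain
  linarith

/-! ### Power-law asymptotics of harmonic tails -/

namespace IsHarmonicTail

variable {H : ℝ → ℝ}

lemma le_mul_rpow_of_forall_ge (hH : IsHarmonicTail μ H) (hμ : IsDisorderLaw μ cm cp) {α : ℝ}
    (hα_pos : 0 < α) (hα : ∫ z, z ^ α ∂μ = 1) {C v : ℝ} (hC : 0 ≤ C)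
    (hv : ∀ u, v ≤ u → 0 < u → H u ≤ C * u ^ α) {u : ℝ} (hu : 0 < u) : H u ≤ C * u ^ α := by
  have h1 : u < max u v + 1 := (le_max_left u v).trans_lt (lt_add_one _)
  refine hH.le_mul_rpow_of_window hμ hα_pos hα hC (fun w hw => hv w ?_ ?_) hu h1
  · linarith [hw.1, le_max_right u v]
  · linarith [hw.1]

/-- By monotonicity `H ≥ H v` on the window `[v, cp v]`, and the lower barrier turns this into a
lower bound for `H` at one fixed point `s`, of order `H v / v ^ α`. -/
lemma exists_le_mul_rpow (hH : IsHarmonicTail μ H) (hμ : IsDisorderLaw μ cm cp) {α : ℝ}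
    (hα_pos : 0 < α) (hα : ∫ z, z ^ α ∂μ = 1) : ∃ K : ℝ, ∀ u, 0 < u → H u ≤ K * u ^ α := by
  obtain ⟨a, b, hb, hba, hlow⟩ := hμ.exists_lower_barrier hα_pos hα
  have hcp : 0 < cp := hμ.cm_pos.trans hμ.cm_lt_cp
  set s := (a + 1) ^ α⁻¹ with hs
  have ha : 0 < a + 1 := by linarith
  have hs1 : 1 ≤ s := Real.one_le_rpow (by linarith) (inv_nonneg.2 hα_pos.le)
  have hsα : s ^ α = a + 1 := Real.rpow_inv_rpow ha.le hα_pos.ne'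
  refine ⟨cp ^ α * H s, fun u hu => ?_⟩
  refine hH.le_mul_rpow_of_forall_ge hμ hα_pos hα (v := s + 1)
    (mul_nonneg (Real.rpow_nonneg hcp.le _) (hH.nonneg s)) (fun v hv hv0 => ?_) hu
  have hD : 0 < (cp * v) ^ α := Real.rpow_pos_of_pos (mul_pos hcp hv0) _
  have hc : 0 ≤ H v / (cp * v) ^ α := div_nonneg (hH.nonneg v) hD.le
  have h := hlow H hH (H v / (cp * v) ^ α) v hc (fun w hw => by
    have : w ^ α ≤ (cp * v) ^ α := Real.rpow_le_rpow (hv0.le.trans hw.1) hw.2 hα_pos.le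
    calc H v / (cp * v) ^ α * w ^ α ≤ H v / (cp * v) ^ α * (cp * v) ^ α :=
          mul_le_mul_of_nonneg_left this hc
      _ = H v := div_mul_cancel₀ _ hD.ne'
      _ ≤ H w := hH.mono hw.1) s hs1 (by linarith)
  have hB : 1 ≤ s ^ α - a + b * s ^ (α - 1) := by
    have : 0 ≤ b * s ^ (α - 1) := mul_nonneg (by linarith) (Real.rpow_nonneg (by linarith) _)
    rw [hsα]
    linarith
  have h1 : H v / (cp * v) ^ α ≤ H s := (le_mul_of_one_le_right hc hB).trans h
  rw [div_le_iff₀ hD, Real.mul_rpow hcp.le hv0.le] at h1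
  linarith

/-- The least constant `C` with `H u ≤ C u ^ α` is positive, and it is nearly attained at
arbitrarily large `u`: otherwise a smaller constant would do at infinity, hence everywhere. -/
lemma exists_least_constant (hH : IsHarmonicTail μ H) (hμ : IsDisorderLaw μ cm cp) {α : ℝ}
    (hα_pos : 0 < α) (hα : ∫ z, z ^ α ∂μ = 1) (hne : ∃ u, H u ≠ 0) :
    ∃ C : ℝ, 0 < C ∧ (∀ u, 0 < u → H u ≤ C * u ^ α) ∧
      ∀ C' < C, ∀ v, ∃ u, v ≤ u ∧ 0 < u ∧ C' * u ^ α ≤ H u := by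
  obtain ⟨K, hK⟩ := hH.exists_le_mul_rpow hμ hα_pos hα
  set S := (fun u => H u / u ^ α) '' Ioi 0
  have hbdd : BddAbove S := by
    refine ⟨K, ?_⟩
    rintro _ ⟨u, hu, rfl⟩
    exact (div_le_iff₀ (Real.rpow_pos_of_pos hu _)).2 (hK u hu)
  have hle : ∀ u, 0 < u → H u ≤ sSup S * u ^ α := fun u hu =>
    (div_le_iff₀ (Real.rpow_pos_of_pos hu _)).1 (le_csSup hbdd ⟨u, hu, rfl⟩)
  refine ⟨sSup S, ?_, hle, fun C' hC' v => ?_⟩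
  · obtain ⟨u, hu⟩ := hne
    obtain ⟨u₀, hu₀, hv⟩ := hH.vanish
    have hu0 : 0 < u := hu₀.trans (by
      by_contra! h
      exact hu (hv u h))
    have h1 : 0 < sSup S * u ^ α := ((hH.nonneg u).lt_of_ne' hu).trans_le (hle u hu0)
    exact pos_of_mul_pos_left h1 (Real.rpow_nonneg hu0.le _)
  · rcases lt_or_ge C' 0 with h | h
    · refine ⟨max v 1, le_max_left _ _, by positivity, ?_⟩
      exact (mul_nonpos_of_nonpos_of_nonneg h.le (by positivity)).trans (hH.nonneg _)
    by_contra! hcon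
    refine hC'.not_ge (csSup_le ⟨_, 1, mem_Ioi.2 one_pos, rfl⟩ ?_)
    rintro _ ⟨u, hu, rfl⟩
    exact (div_le_iff₀ (Real.rpow_pos_of_pos hu _)).2
      (hH.le_mul_rpow_of_forall_ge hμ hα_pos hα h (fun w hw hw0 => (hcon w hw hw0).le) hu)

/-- Quantitative strong maximum principle. If `H u / u ^ α` is close to its upper bound `C`, then
by harmonicity `H (z u) / (z u) ^ α` is close to `C` for most `z` in an interval where the density
of `μ` is bounded below, and by monotonicity of `H` for all `z` in a smaller interval. -/
lemma exists_Icc_near_maximal (hH : IsHarmonicTail μ H) (hμ : IsDisorderLaw μ cm cp) {α : ℝ}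
    (hα_pos : 0 < α) (hα : ∫ z, z ^ α ∂μ = 1) {C : ℝ} (hC : 0 < C)
    (hle : ∀ u, 0 < u → H u ≤ C * u ^ α) :
    ∃ p q : ℝ, 0 < p ∧ p < q ∧ ∀ C' < C, ∃ C'' < C, ∀ u, 0 < u → C'' * u ^ α ≤ H u →
      ∀ z ∈ Icc p q, C' * (z * u) ^ α ≤ H (z * u) := by
  have hprob := hμ.isProbabilityMeasure
  obtain ⟨p₀, q, m, hp₀, hpq, hm, hdens⟩ := hμ.exists_Icc_density_lower_bound
  set p := (p₀ + q) / 2 with hp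
  have hp0 : p₀ < p := by linarith
  have hppos : 0 < p := hp₀.trans hp0
  refine ⟨p, q, hppos, by linarith, fun C' hC' => ?_⟩
  set η := C - C' with hη
  have hηpos : 0 < η := by linarith
  -- `l < 1` is so close to `1` that `(l z, z) ⊆ [p₀, q]` for `z ∈ [p, q]` and `C l ^ α` is near
  -- `C`.
  obtain ⟨l, ⟨hl1, hl2⟩, hl3⟩ : ∃ l : ℝ, (p₀ / p < l ∧ C - η / 2 < C * l ^ α) ∧ l < 1 := by
    have hcont : ContinuousAt (fun l : ℝ => C * l ^ α) 1 :=
      (Real.continuousAt_rpow_const 1 α (Or.inl one_ne_zero)).const_mul C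
    have h1 : ∀ᶠ l : ℝ in 𝓝 1, p₀ / p < l := eventually_gt_nhds ((div_lt_one hppos).2 hp0)
    have h2 : ∀ᶠ l : ℝ in 𝓝 1, C - η / 2 < C * l ^ α :=
      hcont.eventually (eventually_gt_nhds (by simp [hηpos]))
    have h3 : ∀ᶠ l : ℝ in 𝓝[<] 1, l < 1 := eventually_mem_nhdsWithin
    exact (((h1.and h2).filter_mono nhdsWithin_le_nhds).and h3).exists
  have hl0 : 0 < l := (div_pos hp₀ hppos).trans hl1
  have hlp : p₀ < l * p := (div_lt_iff₀ hppos).1 hl1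
  set κ := η / 2 * p ^ α * (m * ((1 - l) * p)) with hκ
  have hpα : 0 < p ^ α := Real.rpow_pos_of_pos hppos _
  have hκpos : 0 < κ := mul_pos (by positivity) (mul_pos hm (mul_pos (by linarith) hppos))
  refine ⟨C - κ / 2, by linarith, fun u hu hHu z hz => ?_⟩
  by_contra! hcon
  have hzpos : 0 < z := hppos.trans_le hz.1
  have huα : 0 < u ^ α := Real.rpow_pos_of_pos hu _
  set d := η / 2 * (p * u) ^ α with hd
  set A := Ioo (l * z) z with hA
  have hμA : m * ((1 - l) * p) ≤ μ.real A := by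
    refine le_trans ?_ (hdens (l * z) z ?_ ?_ hz.2)
    · refine mul_le_mul_of_nonneg_left ?_ hm.le
      nlinarith [hz.1]
    · exact hlp.le.trans (mul_le_mul_of_nonneg_left hz.1 hl0.le)
    · nlinarith
  have hi := (hμ.integrable_mul_rpow α hu).const_mul C
  have hid : Integrable (A.indicator fun _ => d) μ :=
    (integrable_const d).indicator measurableSet_Ioo
  have hbound : H u ≤ ∫ x, (C * (x * u) ^ α - A.indicator (fun _ => d) x) ∂μ := by
    rw [hH.harmonic u]
    refine integral_mono_ae (hH.integrable hμ hu.le) (hi.sub hid) ?_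
    filter_upwards [hμ.ae_mem] with x hx
    have hx0 : 0 < x := hμ.cm_pos.trans_le hx.1
    have hxu : 0 < x * u := mul_pos hx0 hu
    have hstep : H (x * u - 1) ≤ H (x * u) := hH.mono (by linarith)
    by_cases hxA : x ∈ A
    · rw [indicator_of_mem hxA]
      have e1 : H (x * u) ≤ H (z * u) := hH.mono (mul_le_mul_of_nonneg_right hxA.2.le hu.le)
      have e2 : l ^ α * (z * u) ^ α ≤ (x * u) ^ α := by
        rw [← Real.mul_rpow hl0.le (mul_pos hzpos hu).le]
        refine Real.rpow_le_rpow (by positivity) ?_ hα_pos.le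
        rw [← mul_assoc]
        exact mul_le_mul_of_nonneg_right hxA.1.le hu.le
      have e3 : (p * u) ^ α ≤ (z * u) ^ α :=
        Real.rpow_le_rpow (by positivity) (mul_le_mul_of_nonneg_right hz.1 hu.le) hα_pos.le
      have e4 : (C - η / 2) * (z * u) ^ α ≤ C * l ^ α * (z * u) ^ α :=
        mul_le_mul_of_nonneg_right hl2.le (Real.rpow_nonneg (by positivity) _)
      have e5 := mul_le_mul_of_nonneg_left e2 hC.le
      have e6 := mul_le_mul_of_nonneg_left e3 (half_pos hηpos).le
      have e7 : C' * (z * u) ^ α = (C - η / 2) * (z * u) ^ α - η / 2 * (z * u) ^ α := by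
        rw [hη]
        ring
      rw [← mul_assoc] at e5
      linarith
    · rw [indicator_of_notMem hxA, sub_zero]
      exact hstep.trans (hle _ hxu)
  rw [integral_sub hi hid, integral_const_mul, hμ.integral_mul_rpow α hu, hα, one_mul,
    integral_indicator measurableSet_Ioo, setIntegral_const, smul_eq_mul] at hbound
  have hdpos : 0 ≤ d := mul_nonneg (by linarith) (Real.rpow_nonneg (by positivity) _)
  have h1 : κ * u ^ α ≤ μ.real A * d := by
    refine le_trans (le_of_eq ?_) (mul_le_mul_of_nonneg_right hμA hdpos)
    rw [hκ, hd, Real.mul_rpow hppos.le hu.le]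
    ring
  nlinarith [mul_pos hκpos huα]

/-- Iterating the strong maximum principle produces arbitrarily distant windows `[u, cp u]` on which
`H v / v ^ α` is uniformly close to its upper bound. -/
lemma exists_window_near_maximal (hH : IsHarmonicTail μ H) (hμ : IsDisorderLaw μ cm cp) {α : ℝ}
    (hα_pos : 0 < α) (hα : ∫ z, z ^ α ∂μ = 1) {C : ℝ} (hC : 0 < C)
    (hle : ∀ u, 0 < u → H u ≤ C * u ^ α)
    (hmax : ∀ C' < C, ∀ v, ∃ u, v ≤ u ∧ 0 < u ∧ C' * u ^ α ≤ H u) :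
    ∀ C' < C, ∀ v, ∃ u, v ≤ u ∧ ∀ w ∈ Icc u (cp * u), C' * w ^ α ≤ H w := by
  obtain ⟨p, q, hp, hpq, hstep⟩ := hH.exists_Icc_near_maximal hμ hα_pos hα hC hle
  have hq : 0 < q := hp.trans hpq
  have key : ∀ N : ℕ, ∀ C' < C, ∀ v, ∃ u, v ≤ u ∧ 0 < u ∧
      ∀ z ∈ Icc (p ^ N) (q ^ N), C' * (z * u) ^ α ≤ H (z * u) := by
    intro N
    induction N with
    | zero =>
      intro C' hC' v
      obtain ⟨u, hvu, hu, h⟩ := hmax C' hC' v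
      refine ⟨u, hvu, hu, fun z hz => ?_⟩
      obtain rfl : z = 1 := le_antisymm (by simpa using hz.2) (by simpa using hz.1)
      simpa using h
    | succ N ih =>
      intro C' hC' v
      obtain ⟨C'', hC'', hs⟩ := hstep C' hC'
      obtain ⟨u, hvu, hu, h⟩ := ih C'' hC'' v
      refine ⟨u, hvu, hu, fun w hw => ?_⟩
      -- Factor `w = (w / z) z` with `z ∈ [p ^ N, q ^ N]` and `w / z ∈ [p, q]`.
      have hw0 : 0 < w := (pow_pos hp _).trans_le hw.1
      set z := max (p ^ N) (w / q) with hzdef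
      have hz0 : 0 < z := (pow_pos hp N).trans_le (le_max_left _ _)
      have hz : z ∈ Icc (p ^ N) (q ^ N) := by
        refine ⟨le_max_left _ _, max_le (pow_le_pow_left₀ hp.le hpq.le N) ?_⟩
        rw [div_le_iff₀ hq, ← pow_succ]
        exact hw.2
      have hwz : w / z ∈ Icc p q := by
        constructor
        · rw [le_div_iff₀ hz0, mul_comm, ← le_div_iff₀ hp]
          refine max_le ?_ (div_le_div_of_nonneg_left hw0.le hp hpq.le)
          rw [le_div_iff₀ hp, ← pow_succ]
          exact hw.1
        · rw [div_le_iff₀ hz0, mul_comm, ← div_le_iff₀ hq]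
          exact le_max_right _ _
      have := hs (z * u) (mul_pos hz0 hu) (h z hz) (w / z) hwz
      rwa [← mul_assoc, div_mul_cancel₀ _ hz0.ne'] at this
  intro C' hC' v
  obtain ⟨N, hN⟩ := pow_unbounded_of_one_lt cp ((one_lt_div hp).2 hpq)
  have hpN : 0 < p ^ N := pow_pos hp N
  obtain ⟨u, hvu, hu, h⟩ := key N C' hC' (v / p ^ N)
  refine ⟨p ^ N * u, by rwa [div_le_iff₀' hpN] at hvu, fun w hw => ?_⟩
  have := h (w / u) ⟨(le_div_iff₀ hu).2 hw.1, ?_⟩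
  · rwa [div_mul_cancel₀ _ hu.ne'] at this
  · rw [div_le_iff₀ hu]
    refine hw.2.trans ?_
    rw [← mul_assoc]
    refine mul_le_mul_of_nonneg_right ?_ hu.le
    rw [div_pow, lt_div_iff₀ hpN] at hN
    exact hN.le

theorem exists_asymptotics (hH : IsHarmonicTail μ H) (hμ : IsDisorderLaw μ cm cp) {α : ℝ}
    (hα_pos : 0 < α) (hα : ∫ z, z ^ α ∂μ = 1) (hne : ∃ u, H u ≠ 0) :
    ∃ C a : ℝ, 0 < C ∧ ∀ u, 0 < u → C * (u ^ α - a) ≤ H u ∧ H u ≤ C * u ^ α := by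
  obtain ⟨C, hC, hle, hmax⟩ := hH.exists_least_constant hμ hα_pos hα hne
  have hwin := hH.exists_window_near_maximal hμ hα_pos hα hC hle hmax
  obtain ⟨a, b, hb, hba, hlow⟩ := hμ.exists_lower_barrier hα_pos hα
  refine ⟨C, a, hC, fun u hu => ⟨?_, hle u hu⟩⟩
  rcases lt_or_ge u 1 with h1 | h1
  · have : u ^ α ≤ 1 := Real.rpow_le_one hu.le h1.le hα_pos.le
    exact (mul_nonpos_of_nonneg_of_nonpos hC.le (by linarith)).trans (hH.nonneg u)
  set B := u ^ α - a + b * u ^ (α - 1) with hB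
  have hlt : ∀ C' ∈ Ioo 0 C, C' * B ≤ H u := fun C' hC' => by
    obtain ⟨u₁, hu₁, hw⟩ := hwin C' hC'.2 (u + 1)
    exact hlow H hH C' u₁ hC'.1.le hw u h1 (by linarith)
  have hCB : C * B ≤ H u := by
    have hlim : Tendsto (fun C' => C' * B) (𝓝[<] C) (𝓝 (C * B)) :=
      ((continuous_id.mul continuous_const).tendsto C).mono_left nhdsWithin_le_nhds
    refine le_of_tendsto hlim ?_
    filter_upwards [Ioo_mem_nhdsLT hC] with C' hC' using hlt C' hC'
  refine le_trans (mul_le_mul_of_nonneg_left ?_ hC.le) hCB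
  have : 0 ≤ b * u ^ (α - 1) := mul_nonneg (by linarith) (Real.rpow_nonneg hu.le _)
  linarith

end IsHarmonicTail

/-! ### Tails as functions of the reciprocal -/

/-- The tail `ω ((1 / u, ∞))` as a function of `u > 0`, extended by `0` to `u ≤ 0`. In this
variable the event `z x / (1 + x) > 1 / u` reads `(z u - 1) x > 1`, so the limiting chain acts on
tails through `u ↦ z u - 1`. -/
noncomputable def invTail (ω : Measure ℝ) (u : ℝ) : ℝ≥0∞ := ω {x | 0 < x ∧ 1 < u * x}

lemma measurableSet_invTail (u : ℝ) : MeasurableSet {x : ℝ | 0 < x ∧ 1 < u * x} :=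
  measurableSet_Ioi.inter (measurableSet_lt measurable_const (measurable_id.const_mul u))

lemma invTail_mono (ω : Measure ℝ) : Monotone (invTail ω) := fun _ _ huv =>
  measure_mono fun _ hx => ⟨hx.1, hx.2.trans_le (mul_le_mul_of_nonneg_right huv hx.1.le)⟩

lemma measurable_invTail_affine (ω : Measure ℝ) (u : ℝ) :
    Measurable fun z => invTail ω (z * u - 1) :=
  (invTail_mono ω).measurable.comp ((measurable_id.mul_const u).sub_const 1)

lemma invTail_of_nonpos (ω : Measure ℝ) {u : ℝ} (hu : u ≤ 0) : invTail ω u = 0 := by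
  have : {x : ℝ | 0 < x ∧ 1 < u * x} = ∅ := by
    ext x
    simp only [mem_ofPred_eq, mem_empty_iff_false, iff_false, not_and, not_lt]
    intro hx
    exact (mul_nonpos_of_nonpos_of_nonneg hu hx.le).trans zero_le_one
  rw [invTail, this, measure_empty]

lemma invTail_one_div (ω : Measure ℝ) {σ : ℝ} (hσ : 0 < σ) : invTail ω (1 / σ) = ω (Ioi σ) := by
  refine congrArg ω ?_
  ext x
  simp only [mem_ofPred_eq, mem_Ioi, one_div, inv_mul_eq_div, one_lt_div hσ]
  exact ⟨fun h => h.2, fun h => ⟨hσ.trans h, h⟩⟩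

lemma invTail_eq_iSup (ω : Measure ℝ) {s : ℕ → ℝ} {t : ℝ} (hs : Monotone s)
    (hst : Tendsto s atTop (𝓝 t)) : invTail ω t = ⨆ n, invTail ω (s n) := by
  have hmono : Monotone fun n => {x : ℝ | 0 < x ∧ 1 < s n * x} := fun m n hmn x hx =>
    ⟨hx.1, hx.2.trans_le (mul_le_mul_of_nonneg_right (hs hmn) hx.1.le)⟩
  rw [invTail, show {x : ℝ | 0 < x ∧ 1 < t * x} = ⋃ n, {x : ℝ | 0 < x ∧ 1 < s n * x} from ?_,
    hmono.measure_iUnion]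
  · rfl
  ext x
  simp only [mem_ofPred_eq, mem_iUnion, exists_and_left]
  refine and_congr_right fun hx => ⟨fun h => ?_, fun ⟨n, hn⟩ => ?_⟩
  · exact ((hst.mul_const x).eventually (eventually_gt_nhds h)).exists
  · exact hn.trans_le (mul_le_mul_of_nonneg_right (hs.ge_of_tendsto hst n) hx.le)

lemma exists_seq_mono_lt_tendsto (u : ℝ) :
    ∃ s : ℕ → ℝ, Monotone s ∧ (∀ n, s n < u) ∧ Tendsto s atTop (𝓝 u) := by
  obtain ⟨s, hs, hlt, ht⟩ := exists_seq_strictMono_tendsto u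
  exact ⟨s, hs.monotone, hlt, ht⟩

lemma invTail_le_of_forall_lt (ω : Measure ℝ) {u : ℝ} {c : ℝ≥0∞}
    (h : ∀ v < u, invTail ω v ≤ c) : invTail ω u ≤ c := by
  obtain ⟨s, hs, hlt, ht⟩ := exists_seq_mono_lt_tendsto u
  rw [invTail_eq_iSup ω hs ht]
  exact iSup_le fun n => h _ (hlt n)

lemma lintegral_invTail_le_of_forall_lt (hμ : IsDisorderLaw μ cm cp) (ω : Measure ℝ) {u : ℝ}
    {c : ℝ≥0∞} (h : ∀ v < u, ∫⁻ z, invTail ω (z * v - 1) ∂μ ≤ c) :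
    ∫⁻ z, invTail ω (z * u - 1) ∂μ ≤ c := by
  obtain ⟨s, hs, hlt, ht⟩ := exists_seq_mono_lt_tendsto u
  have hs' : ∀ z, 0 ≤ z → Monotone fun n => z * s n - 1 := fun z hz m n hmn =>
    sub_le_sub_right (mul_le_mul_of_nonneg_left (hs hmn) hz) 1
  have h1 : ∫⁻ z, invTail ω (z * u - 1) ∂μ = ∫⁻ z, ⨆ n, invTail ω (z * s n - 1) ∂μ := by
    refine lintegral_congr_ae ?_
    filter_upwards [hμ.ae_mem] with z hz
    exact invTail_eq_iSup ω (hs' z (hμ.cm_pos.le.trans hz.1)) ((ht.const_mul z).sub_const 1)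
  rw [h1, lintegral_iSup' (fun n => (measurable_invTail_affine ω (s n)).aemeasurable)]
  · exact iSup_le fun n => h _ (hlt n)
  · filter_upwards [hμ.ae_mem] with z hz
    exact fun m n hmn => invTail_mono ω (hs' z (hμ.cm_pos.le.trans hz.1) hmn)

/-! ### The rescaled stationary laws -/

lemma map_sq_mul_Ioi (ν : Measure ℝ) {ε : ℝ} (hε : 0 < ε) (σ : ℝ) :
    (ν.map fun s => ε ^ 2 * s) (Ioi σ) = ν (Ioi (σ / ε ^ 2)) := by
  rw [Measure.map_apply (measurable_id'.const_mul _) measurableSet_Ioi]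
  refine congrArg ν ?_
  ext s
  simp [div_lt_iff₀' (pow_pos hε 2)]

namespace IsStationaryLaw

variable {ε y : ℝ} {ν : Measure ℝ}

/-- Stationarity of the rescaled chain `x ↦ Z (ε² + x) / (1 + x)`, on tails. -/
lemma invTail_map_eq (hν : IsStationaryLaw μ ε ν) (hμ : IsDisorderLaw μ cm cp)
    (hε : ε ∈ Ioo (0 : ℝ) 1) (u : ℝ) :
    invTail (ν.map fun s => ε ^ 2 * s) u =
      ∫⁻ z, (ν.map fun s => ε ^ 2 * s) {x | 0 < x ∧ 1 + x < u * z * (ε ^ 2 + x)} ∂μ := by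
  have hprob := hμ.isProbabilityMeasure
  have hprob' := hν.isProbabilityMeasure
  have hε2 : 0 < ε ^ 2 := pow_pos hε.1 2
  have hmul : Measurable fun s : ℝ => ε ^ 2 * s := measurable_id.const_mul _
  have hg : Measurable fun p : ℝ × ℝ => p.1 * g ε p.2 := by
    unfold g
    fun_prop
  have hpos : ∀ᵐ s ∂ν, 0 < s := by
    rw [ae_iff]
    simpa [Iic] using hν.measure_Iic_zero
  rw [invTail, Measure.map_apply hmul (measurableSet_invTail u)]
  conv_lhs => rw [← hν.stationary, T]
  rw [Measure.map_apply hg (hmul (measurableSet_invTail u)),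
    Measure.prod_apply (hg (hmul (measurableSet_invTail u)))]
  refine lintegral_congr_ae ?_
  filter_upwards [hμ.ae_mem] with z hz
  have hz0 : 0 < z := hμ.cm_pos.trans_le hz.1
  rw [Measure.map_apply hmul]
  · refine measure_congr ?_
    filter_upwards [hpos] with s hs
    refine propext ?_
    change (0 < ε ^ 2 * (z * g ε s) ∧ 1 < u * (ε ^ 2 * (z * g ε s))) ↔
      (0 < ε ^ 2 * s ∧ 1 + ε ^ 2 * s < u * z * (ε ^ 2 + ε ^ 2 * s))
    have hden : 0 < 1 + ε ^ 2 * s := by positivity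
    have e : u * (ε ^ 2 * (z * g ε s)) = u * z * (ε ^ 2 + ε ^ 2 * s) / (1 + ε ^ 2 * s) := by
      rw [g]
      field_simp
    rw [e, one_lt_div hden]
    have h1 : 0 < ε ^ 2 * (z * g ε s) := by
      rw [g]
      positivity
    have h2 : 0 < ε ^ 2 * s := by positivity
    simp only [h1, h2, true_and]
  · exact measurableSet_Ioi.inter (measurableSet_lt (f := fun x : ℝ => 1 + x)
      (g := fun x : ℝ => u * z * (ε ^ 2 + x)) (by fun_prop) (by fun_prop))

lemma lintegral_invTail_map_le (hν : IsStationaryLaw μ ε ν) (hμ : IsDisorderLaw μ cm cp)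
    (hε : ε ∈ Ioo (0 : ℝ) 1) (u : ℝ) :
    ∫⁻ z, invTail (ν.map fun s => ε ^ 2 * s) (z * u - 1) ∂μ ≤
      invTail (ν.map fun s => ε ^ 2 * s) u := by
  rw [hν.invTail_map_eq hμ hε u]
  refine lintegral_mono_ae ?_
  filter_upwards [hμ.ae_mem] with z hz
  have hz0 : 0 < z := hμ.cm_pos.trans_le hz.1
  rcases le_or_gt u 0 with hu | hu
  · rw [invTail_of_nonpos _ (by nlinarith)]
    exact zero_le
  refine measure_mono fun x hx => ⟨hx.1, ?_⟩
  have h1 := hx.2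
  have h2 : 0 ≤ u * z * ε ^ 2 := by positivity
  linarith

/-- A converse to `lintegral_invTail_map_le`: the term `ε²` of the rescaled chain costs a slight
increase of the level from `u` to `v`. -/
lemma invTail_map_le_lintegral (hν : IsStationaryLaw μ ε ν) (hμ : IsDisorderLaw μ cm cp)
    (hε : ε ∈ Ioo (0 : ℝ) 1) {u v : ℝ} (hu : 0 < u) (hv : 0 ≤ v)
    (huv : u ≤ v * (1 - u * cp * ε ^ 2)) :
    invTail (ν.map fun s => ε ^ 2 * s) u ≤
      ∫⁻ z, invTail (ν.map fun s => ε ^ 2 * s) (z * v - 1) ∂μ := by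
  rw [hν.invTail_map_eq hμ hε u]
  refine lintegral_mono_ae ?_
  filter_upwards [hμ.ae_mem] with z hz
  refine measure_mono fun x hx => ⟨hx.1, ?_⟩
  have hx0 : 0 < x := hx.1
  have hcp : 0 < cp := hμ.cm_pos.trans hμ.cm_lt_cp
  have hz0 : 0 < z := hμ.cm_pos.trans_le hz.1
  have hv0 : 0 < v := by
    rcases hv.eq_or_lt with rfl | h
    · linarith
    · exact h
  have h1 : 1 + x < u * z * (ε ^ 2 + x) := hx.2
  have h2 : u * z * ε ^ 2 ≤ u * cp * ε ^ 2 := by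
    have := hz.2
    gcongr
  have h3 : 0 ≤ u * cp * ε ^ 2 * x := by positivity
  have h4 : (1 - u * cp * ε ^ 2) * (1 + x) < u * (z * x) := by nlinarith
  have h5 : u * (1 + x) < u * (z * v * x) := by
    calc u * (1 + x) ≤ v * (1 - u * cp * ε ^ 2) * (1 + x) :=
          mul_le_mul_of_nonneg_right huv (by linarith)
      _ = v * ((1 - u * cp * ε ^ 2) * (1 + x)) := by ring
      _ < v * (u * (z * x)) := mul_lt_mul_of_pos_left h4 hv0
      _ = u * (z * v * x) := by ring
  have h6 := lt_of_mul_lt_mul_left h5 hu.le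
  linarith

end IsStationaryLaw

/-- Tightness away from `0`. From any level the chain climbs above `y < cp - 1` in finitely many
steps by drawing values of `Z` close to `cp`, an event whose probability is bounded below. Hence
tails at any level are controlled by the tail at level `y`, uniformly over superharmonic tails. -/
lemma IsDisorderLaw.exists_superharmonic_le (hμ : IsDisorderLaw μ cm cp) {y : ℝ} (hy : 0 < y)
    (hycp : y < cp - 1) (v : ℝ) :
    ∃ K : ℝ≥0∞, K ≠ ∞ ∧ ∀ h : ℝ → ℝ≥0∞, Monotone h →
      (∀ u, ∫⁻ z, h (z * u - 1) ∂μ ≤ h u) → h v ≤ K * h (1 / y) := by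
  have hprob := hμ.isProbabilityMeasure
  obtain ⟨c, hc, hccp⟩ := exists_between (show 1 + y < cp by linarith)
  set m := μ (Ioi c)
  have hm : m ≠ 0 := fun hm => by
    have h1 : μ (Icc cm c) = 1 := by
      rw [← mem_ae_iff_prob_eq_one measurableSet_Icc]
      have h2 : ∀ᵐ z ∂μ, z ≤ c := by
        rw [ae_iff]
        simpa [m, Ioi] using hm
      filter_upwards [h2, hμ.ae_mem] with z hz hz' using ⟨hz'.1, hz⟩
    exact absurd (hμ.minimal _ _ h1 (right_mem_Icc.2 hμ.cm_lt_cp.le)).2 (by linarith)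
  have hm1 : m ≤ 1 := prob_le_one
  set κ := c / (1 + y) with hκ
  have hκ1 : 1 < κ := (one_lt_div (by linarith)).2 hc
  have hκ0 : 0 < κ := by linarith
  obtain ⟨N, hN⟩ := pow_unbounded_of_one_lt (v * y) hκ1
  refine ⟨(m ^ N)⁻¹, ENNReal.inv_ne_top.2 (pow_ne_zero _ hm), fun h hmono hsup => ?_⟩
  have hstep : ∀ w, 1 / y ≤ w → m * h w ≤ h (w / κ) := fun w hw => by
    have hw0 : 0 < w := (one_div_pos.2 hy).trans_le hw
    refine le_trans ?_ (hsup (w / κ))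
    calc m * h w = ∫⁻ _ in Ioi c, h w ∂μ := by rw [setLIntegral_const, mul_comm]
      _ ≤ ∫⁻ z in Ioi c, h (z * (w / κ) - 1) ∂μ := by
        refine setLIntegral_mono' measurableSet_Ioi fun z hz => hmono ?_
        have h1 : c * (w / κ) ≤ z * (w / κ) :=
          mul_le_mul_of_nonneg_right (mem_Ioi.1 hz).le (by positivity)
        have h2 : c * (w / κ) = w * (1 + y) := by
          have : c ≠ 0 := by linarith
          have : 1 + y ≠ 0 := by linarith
          rw [hκ]
          field_simp
        have h3 : 1 ≤ w * y := (div_le_iff₀ hy).1 hw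
        linarith
      _ ≤ ∫⁻ z, h (z * (w / κ) - 1) ∂μ := setLIntegral_le_lintegral _ _
  have key : ∀ n : ℕ, ∀ w, w * y ≤ κ ^ n → m ^ n * h w ≤ h (1 / y) := by
    intro n
    induction n with
    | zero =>
      intro w hw
      rw [pow_zero, one_mul]
      exact hmono ((le_div_iff₀ hy).2 (by simpa using hw))
    | succ n ih =>
      intro w hw
      rcases le_total w (1 / y) with h1 | h1
      · exact (mul_le_of_le_one_left zero_le (pow_le_one' hm1 _)).trans (hmono h1)
      · rw [pow_succ, mul_assoc]
        refine (mul_le_mul_right (hstep w h1) _).trans (ih _ ?_)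
        rw [div_mul_eq_mul_div, div_le_iff₀ hκ0, ← pow_succ]
        exact hw
  have hmN : m ^ N ≠ ∞ := ENNReal.pow_ne_top (measure_ne_top _ _)
  calc h v = (m ^ N)⁻¹ * (m ^ N * h v) := by
        rw [← mul_assoc, ENNReal.inv_mul_cancel (pow_ne_zero _ hm) hmN, one_mul]
    _ ≤ (m ^ N)⁻¹ * h (1 / y) := mul_le_mul_right (key N v hN.le) _

namespace IsStationaryLaw

variable {ε y : ℝ} {ν : Measure ℝ}

/-- The normalising tail `ν_ε ((y / ε², ∞))` is positive, so that `omega` is not a junk value. -/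
lemma measure_Ioi_ne_zero (hν : IsStationaryLaw μ ε ν) (hμ : IsDisorderLaw μ cm cp)
    (hε : ε ∈ Ioo (0 : ℝ) 1) (hy : 0 < y) (hycp : y < cp - 1) : ν (Ioi (y / ε ^ 2)) ≠ 0 := by
  intro h0
  have hprob := hν.isProbabilityMeasure
  set l := ν.map fun s => ε ^ 2 * s
  have hIoi : ∀ σ, l (Ioi σ) = ν (Ioi (σ / ε ^ 2)) := map_sq_mul_Ioi ν hε.1
  have hall : ∀ n : ℕ, l (Ioi (1 / ((n : ℝ) + 1))) = 0 := fun n => by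
    obtain ⟨K, -, hK⟩ := hμ.exists_superharmonic_le hy hycp ((n : ℝ) + 1)
    have h1 := hK (invTail l) (invTail_mono l) (hν.lintegral_invTail_map_le hμ hε)
    rw [invTail_one_div l hy, hIoi, h0, mul_zero] at h1
    rw [← invTail_one_div l (by positivity), one_div_one_div]
    exact le_antisymm h1 zero_le
  have hU : ⋃ n : ℕ, Ioi (1 / ((n : ℝ) + 1)) = Ioi 0 := by
    ext x
    simp only [mem_iUnion, mem_Ioi]
    exact ⟨fun ⟨n, hn⟩ => lt_trans (by positivity) hn, exists_nat_one_div_lt⟩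
  have h1 : l (Ioi 0) = 0 := by
    rw [← hU]
    exact measure_iUnion_null hall
  rw [hIoi, zero_div, ← compl_Iic, prob_compl_eq_zero_iff measurableSet_Iic,
    hν.measure_Iic_zero] at h1
  exact zero_ne_one h1

lemma invTail_omega (y ε : ℝ) (ν : Measure ℝ) (u : ℝ) : invTail (omega y ε ν) u =
    (ν (Ioi (y / ε ^ 2)))⁻¹ * invTail (ν.map fun s => ε ^ 2 * s) u := by
  rw [invTail, omega, Measure.smul_apply, smul_eq_mul, invTail]

lemma invTail_omega_one_div (hν : IsStationaryLaw μ ε ν) (hμ : IsDisorderLaw μ cm cp)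
    (hε : ε ∈ Ioo (0 : ℝ) 1) (hy : 0 < y) (hycp : y < cp - 1) :
    invTail (omega y ε ν) (1 / y) = 1 := by
  have hprob := hν.isProbabilityMeasure
  rw [invTail_omega, invTail_one_div _ hy, map_sq_mul_Ioi ν hε.1]
  exact ENNReal.inv_mul_cancel (hν.measure_Ioi_ne_zero hμ hε hy hycp) (measure_ne_top _ _)

lemma lintegral_invTail_omega_le (hν : IsStationaryLaw μ ε ν) (hμ : IsDisorderLaw μ cm cp)
    (hε : ε ∈ Ioo (0 : ℝ) 1) (u : ℝ) :
    ∫⁻ z, invTail (omega y ε ν) (z * u - 1) ∂μ ≤ invTail (omega y ε ν) u := by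
  simp only [invTail_omega]
  rw [lintegral_const_mul _ (measurable_invTail_affine _ u)]
  exact mul_le_mul_right (hν.lintegral_invTail_map_le hμ hε u) _

lemma invTail_omega_le_lintegral (hν : IsStationaryLaw μ ε ν) (hμ : IsDisorderLaw μ cm cp)
    (hε : ε ∈ Ioo (0 : ℝ) 1) {u v : ℝ} (hu : 0 < u) (hv : 0 ≤ v)
    (huv : u ≤ v * (1 - u * cp * ε ^ 2)) :
    invTail (omega y ε ν) u ≤ ∫⁻ z, invTail (omega y ε ν) (z * v - 1) ∂μ := by
  simp only [invTail_omega]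
  rw [lintegral_const_mul _ (measurable_invTail_affine _ v)]
  exact mul_le_mul_right (hν.invTail_map_le_lintegral hμ hε hu hv huv) _

end IsStationaryLaw

/-! ### Passage to the limit -/

/-- A test function squeezed between the indicators of `(1 / u, ∞)` and `(1 / v, ∞)`. -/
lemma exists_test_function {u v : ℝ} (hu : 0 < u) (huv : u < v) :
    ∃ f : ℝ →ᵇ ℝ≥0, (∃ δ : ℝ, 0 < δ ∧ ∀ x ≤ δ, f x = 0) ∧ ∀ ω : Measure ℝ,
      invTail ω u ≤ ∫⁻ x, f x ∂ω ∧ ∫⁻ x, f x ∂ω ≤ invTail ω v := by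
  have hv : 0 < v := hu.trans huv
  have hlt : 1 / v < 1 / u := one_div_lt_one_div_of_lt hu huv
  set f := thickenedIndicator (sub_pos.2 hlt) (Ici (1 / u))
  have hzero : ∀ x ≤ 1 / v, f x = 0 := fun x hx => by
    refine thickenedIndicator_zero _ _ fun hmem => ?_
    obtain ⟨z, hz, hxz⟩ := Metric.mem_thickening_iff.1 hmem
    rw [Real.dist_eq, abs_lt] at hxz
    linarith [mem_Ici.1 hz, hxz.1]
  refine ⟨f, ⟨1 / v, one_div_pos.2 hv, hzero⟩, fun ω => ⟨?_, ?_⟩⟩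
  · rw [← one_div_one_div u, invTail_one_div ω (one_div_pos.2 hu),
      ← lintegral_indicator_one measurableSet_Ioi]
    refine lintegral_mono fun x => ?_
    by_cases hx : x ∈ Ioi (1 / u)
    · have : f x = 1 := thickenedIndicator_one _ _ (mem_Ici.2 (le_of_lt hx))
      rw [indicator_of_mem hx, this]
      exact le_rfl
    · rw [indicator_of_notMem hx]
      exact zero_le
  · rw [← one_div_one_div v, invTail_one_div ω (one_div_pos.2 hv),
      ← lintegral_indicator_one measurableSet_Ioi]
    refine lintegral_mono fun x => ?_
    by_cases hx : x ∈ Ioi (1 / v)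
    · rw [indicator_of_mem hx]
      exact ENNReal.coe_le_one_iff.2 (thickenedIndicator_le_one _ _ _)
    · rw [indicator_of_notMem hx, hzero x (not_lt.1 hx)]
      simp

namespace TendstoAwayFromZero

variable {ω : ℕ → Measure ℝ} {ω₀ : Measure ℝ}

lemma invTail_le_liminf (h : TendstoAwayFromZero ω ω₀) {u v : ℝ} (huv : u < v) :
    invTail ω₀ u ≤ liminf (fun n => invTail (ω n) v) atTop := by
  rcases le_or_gt u 0 with hu | hu
  · rw [invTail_of_nonpos _ hu]
    exact zero_le
  obtain ⟨f, hf, hbd⟩ := exists_test_function hu huv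
  calc invTail ω₀ u ≤ ∫⁻ x, f x ∂ω₀ := (hbd ω₀).1
    _ = liminf (fun n => ∫⁻ x, (f x : ℝ≥0∞) ∂(ω n)) atTop := (h f hf).liminf_eq.symm
    _ ≤ _ := liminf_le_liminf (Eventually.of_forall fun n => (hbd (ω n)).2)

lemma limsup_invTail_le (h : TendstoAwayFromZero ω ω₀) {u v : ℝ} (huv : u < v) :
    limsup (fun n => invTail (ω n) u) atTop ≤ invTail ω₀ v := by
  rcases le_or_gt u 0 with hu | hu
  · simp [invTail_of_nonpos _ hu]
  obtain ⟨f, hf, hbd⟩ := exists_test_function hu huv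
  calc limsup (fun n => invTail (ω n) u) atTop
      ≤ limsup (fun n => ∫⁻ x, (f x : ℝ≥0∞) ∂(ω n)) atTop :=
        limsup_le_limsup (Eventually.of_forall fun n => (hbd (ω n)).1)
    _ = ∫⁻ x, f x ∂ω₀ := (h f hf).limsup_eq
    _ ≤ _ := (hbd ω₀).2

end TendstoAwayFromZero

namespace IsLimitPoint

variable {y : ℝ} {ω₀ : Measure ℝ}

lemma invTail_ne_top (hω₀ : IsLimitPoint μ y ω₀) (hμ : IsDisorderLaw μ cm cp) (hy : 0 < y)
    (hycp : y < cp - 1) (u : ℝ) : invTail ω₀ u ≠ ∞ := by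
  obtain ⟨-, ε, ν, hε, -, hν, hlim⟩ := hω₀
  obtain ⟨K, hK, hle⟩ := hμ.exists_superharmonic_le hy hycp (u + 1)
  refine ne_top_of_le_ne_top hK ((hlim.invTail_le_liminf (lt_add_one u)).trans ?_)
  refine (liminf_le_liminf (v := fun _ => K) (Eventually.of_forall fun n => ?_)).trans
    (liminf_const K).le
  have := hle _ (invTail_mono (omega y (ε n) (ν n)))
    ((hν n).lintegral_invTail_omega_le hμ (hε n))
  rwa [(hν n).invTail_omega_one_div hμ (hε n) hy hycp, mul_one] at this

lemma exists_invTail_ne_zero (hω₀ : IsLimitPoint μ y ω₀) (hμ : IsDisorderLaw μ cm cp) (hy : 0 < y)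
    (hycp : y < cp - 1) : ∃ u, invTail ω₀ u ≠ 0 := by
  obtain ⟨-, ε, ν, hε, -, hν, hlim⟩ := hω₀
  refine ⟨1 / y + 1, fun h0 => ?_⟩
  have h := hlim.limsup_invTail_le (lt_add_one (1 / y))
  simp only [h0, fun n => (hν n).invTail_omega_one_div hμ (hε n) hy hycp, limsup_const] at h
  exact absurd h (by simp)

lemma lintegral_invTail_le (hω₀ : IsLimitPoint μ y ω₀) (hμ : IsDisorderLaw μ cm cp) (u : ℝ) :
    ∫⁻ z, invTail ω₀ (z * u - 1) ∂μ ≤ invTail ω₀ u := by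
  obtain ⟨-, ε, ν, hε, -, hν, hlim⟩ := hω₀
  refine lintegral_invTail_le_of_forall_lt hμ ω₀ fun v hv => ?_
  obtain ⟨w, hvw, hwu⟩ := exists_between hv
  calc ∫⁻ z, invTail ω₀ (z * v - 1) ∂μ
      ≤ ∫⁻ z, liminf (fun n => invTail (omega y (ε n) (ν n)) (z * w - 1)) atTop ∂μ := by
        refine lintegral_mono_ae ?_
        filter_upwards [hμ.ae_mem] with z hz
        have := mul_lt_mul_of_pos_left hvw (hμ.cm_pos.trans_le hz.1)
        exact hlim.invTail_le_liminf (by linarith)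
    _ ≤ liminf (fun n => ∫⁻ z, invTail (omega y (ε n) (ν n)) (z * w - 1) ∂μ) atTop :=
        lintegral_liminf_le fun n => measurable_invTail_affine _ w
    _ ≤ liminf (fun n => invTail (omega y (ε n) (ν n)) w) atTop :=
        liminf_le_liminf (Eventually.of_forall fun n =>
          (hν n).lintegral_invTail_omega_le hμ (hε n) w)
    _ ≤ limsup (fun n => invTail (omega y (ε n) (ν n)) w) atTop := liminf_le_limsup
    _ ≤ invTail ω₀ u := hlim.limsup_invTail_le hwu

lemma invTail_le_lintegral (hω₀ : IsLimitPoint μ y ω₀) (hμ : IsDisorderLaw μ cm cp) (hy : 0 < y)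
    (hycp : y < cp - 1) (u : ℝ) :
    invTail ω₀ u ≤ ∫⁻ z, invTail ω₀ (z * u - 1) ∂μ := by
  obtain ⟨-, ε, ν, hε, hε0, hν, hlim⟩ := hω₀
  have hprob := hμ.isProbabilityMeasure
  refine invTail_le_of_forall_lt ω₀ fun v hv => ?_
  rcases le_or_gt v 0 with hv0 | hv0
  · rw [invTail_of_nonpos _ hv0]
    exact zero_le
  obtain ⟨w, hvw, hwu⟩ := exists_between hv
  obtain ⟨t, hwt, htu⟩ := exists_between hwu
  have hw0 : 0 < w := hv0.trans hvw
  have ht0 : 0 < t := hw0.trans hwt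
  obtain ⟨K, hK, hle⟩ := hμ.exists_superharmonic_le hy hycp (cp * t - 1)
  -- The term `ε²` in the rescaled chain is absorbed by the slack between `w` and `t`.
  have hev : ∀ᶠ n in atTop, w ≤ t * (1 - w * cp * ε n ^ 2) := by
    have h1 : Tendsto (fun n => t * (1 - w * cp * ε n ^ 2)) atTop
        (𝓝 (t * (1 - w * cp * 0 ^ 2))) :=
      (((hε0.pow 2).const_mul (w * cp)).const_sub 1).const_mul t
    filter_upwards [h1.eventually (eventually_gt_nhds (by simpa using hwt))] with n hn using hn.le
  calc invTail ω₀ v ≤ liminf (fun n => invTail (omega y (ε n) (ν n)) w) atTop :=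
        hlim.invTail_le_liminf hvw
    _ ≤ limsup (fun n => invTail (omega y (ε n) (ν n)) w) atTop := liminf_le_limsup
    _ ≤ limsup (fun n => ∫⁻ z, invTail (omega y (ε n) (ν n)) (z * t - 1) ∂μ) atTop := by
        refine limsup_le_limsup ?_
        filter_upwards [hev] with n hn
        exact (hν n).invTail_omega_le_lintegral hμ (hε n) hw0 ht0.le hn
    _ ≤ ∫⁻ z, limsup (fun n => invTail (omega y (ε n) (ν n)) (z * t - 1)) atTop ∂μ := by
        refine limsup_lintegral_le (fun _ => K) (fun n => measurable_invTail_affine _ t)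
          (fun n => ?_) (by simpa using hK)
        filter_upwards [hμ.ae_mem] with z hz
        have h1 := hle _ (invTail_mono (omega y (ε n) (ν n)))
          ((hν n).lintegral_invTail_omega_le hμ (hε n))
        rw [(hν n).invTail_omega_one_div hμ (hε n) hy hycp, mul_one] at h1
        refine (invTail_mono _ ?_).trans h1
        linarith [mul_le_mul_of_nonneg_right hz.2 ht0.le]
    _ ≤ ∫⁻ z, invTail ω₀ (z * u - 1) ∂μ := by
        refine lintegral_mono_ae ?_
        filter_upwards [hμ.ae_mem] with z hz
        have := mul_lt_mul_of_pos_left htu (hμ.cm_pos.trans_le hz.1)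
        exact hlim.limsup_invTail_le (by linarith)

/-- The tail of a limit point is invariant under the limiting chain `x ↦ Z x / (1 + x)`. -/
lemma isHarmonicTail (hω₀ : IsLimitPoint μ y ω₀) (hμ : IsDisorderLaw μ cm cp) (hy : 0 < y)
    (hycp : y < cp - 1) : IsHarmonicTail μ fun u => (invTail ω₀ u).toReal := by
  have hfin := hω₀.invTail_ne_top hμ hy hycp
  have heq : ∀ u, invTail ω₀ u = ∫⁻ z, invTail ω₀ (z * u - 1) ∂μ := fun u =>
    le_antisymm (hω₀.invTail_le_lintegral hμ hy hycp u) (hω₀.lintegral_invTail_le hμ u)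
  have hcp : 0 < cp := hμ.cm_pos.trans hμ.cm_lt_cp
  refine ⟨fun u v huv => ENNReal.toReal_mono (hfin v) (invTail_mono ω₀ huv),
    ⟨1 / cp, one_div_pos.2 hcp, fun u hu => ?_⟩, fun u => ?_⟩
  · have h0 : invTail ω₀ u = 0 := by
      rcases le_or_gt u 0 with h | h
      · exact invTail_of_nonpos ω₀ h
      rw [heq u]
      refine (lintegral_congr_ae ?_).trans lintegral_zero
      filter_upwards [hμ.ae_mem] with z hz
      have h1 : z * u ≤ cp * u := mul_le_mul_of_nonneg_right hz.2 h.le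
      have h2 : u * cp ≤ 1 := (le_div_iff₀ hcp).1 hu
      exact invTail_of_nonpos ω₀ (by linarith)
    simp [h0]
  · rw [integral_toReal (measurable_invTail_affine ω₀ u).aemeasurable
      (Eventually.of_forall fun z => (hfin _).lt_top), ← heq u]

end IsLimitPoint

end DerridaHilhorst

theorem lemma4p10 (μ : Measure ℝ) (cm cp : ℝ) (hμ : DerridaHilhorst.IsDisorderLaw μ cm cp)
    (α : ℝ) (hα_pos : 0 < α) (hα : ∫ z, z ^ α ∂μ = 1)
    (y : ℝ) (hy : y ∈ Ioo 0 (min (cp - 1) (cp / 2)))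
    (ω₀ : Measure ℝ) (hω₀ : DerridaHilhorst.IsLimitPoint μ y ω₀) :
    ∃ (R : ℝ → ℝ) (C : ℝ), C ≠ 0 ∧
      (∀ σ : ℝ, 0 < σ →
        ω₀ (Ioi σ) < ∞ ∧ (ω₀ (Ioi σ)).toReal = C * (σ ^ (-α) + R σ)) ∧
      R =O[𝓝[>] 0] (fun _ => (1 : ℝ)) := by
  have hycp : y < cp - 1 := hy.2.trans_le (min_le_left _ _)
  have hfin := hω₀.invTail_ne_top hμ hy.1 hycp
  obtain ⟨u, hu⟩ := hω₀.exists_invTail_ne_zero hμ hy.1 hycp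
  obtain ⟨C, a, hC, hbd⟩ := (hω₀.isHarmonicTail hμ hy.1 hycp).exists_asymptotics hμ hα_pos hα
    ⟨u, ENNReal.toReal_ne_zero.2 ⟨hu, hfin u⟩⟩
  refine ⟨fun σ => (ω₀ (Ioi σ)).toReal / C - σ ^ (-α), C, hC.ne', fun σ hσ => ⟨?_, ?_⟩, ?_⟩
  · rw [← DerridaHilhorst.invTail_one_div ω₀ hσ]
    exact (hfin _).lt_top
  · rw [add_sub_cancel, mul_div_cancel₀ _ hC.ne']
  · refine Asymptotics.IsBigO.of_bound |a| ?_
    filter_upwards [self_mem_nhdsWithin] with σ hσ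
    have hσ0 : 0 < σ := hσ
    obtain ⟨h1, h2⟩ := hbd (1 / σ) (one_div_pos.2 hσ0)
    rw [DerridaHilhorst.invTail_one_div ω₀ hσ0, one_div, Real.inv_rpow hσ0.le,
      ← Real.rpow_neg hσ0.le] at h1 h2
    rw [← le_div_iff₀' hC] at h1
    rw [← div_le_iff₀' hC] at h2
    rw [norm_one, mul_one, Real.norm_eq_abs, abs_le]
    constructor <;> linarith [le_abs_self a, abs_nonneg a]
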